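/- **Conventions.** All Hilbert spaces are complex with inner product linear in the first entry. A linear relation from $X$ to $Y$ is a linear subspace of $X\times Y$ (operators are identified with their graphs). For a linear relation $T$ in $\mathfrak H$, $T^*=\{\{h,k\}:(k,f)=(h,g)\text{ for all }\{f,g\}\in T\}$; $T$ is symmetric (dissipative, accumulative) if $\operatorname{Im}(h',h)=0$ ($\ge 0$, $\le 0$) for all $\{h,h'\}\in T$, and maximal dissipative (accumulative) if it has no proper dissipative (accumulative) extension. $[\mathcal H]$ denotes the bounded everywhere defined operators on $\mathcal H$. For $\{f,f'\}$ write $\widehat f$. *Boundary relation.* Let $S$ be a closed symmetric linear relation in $\mathfrak H$. A linear relation $\Gamma:\mathfrak H^2\to\mathcal H^2$ is a boundary relation for $S^*$ if $\operatorname{dom}\Gamma$ is a dense subset of $S^*$, Green's identity $$(f',g)-(f,g')=(h',k)-(h,k')\qquad(\ast)$$ holds for all $\{\widehat f,\widehat h\},\{\widehat g,\widehat k\}\in\Gamma$, and every $\{\widehat g,\widehat k\}\in\mathfrak H^2\times\mathcal H^2$ that satisfies $(\ast)$ for all $\{\widehat f,\widehat h\}\in\Gamma$ belongs to $\Gamma$.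 Its Weyl family is $\lambda\mapsto\{\widehat h:\{\{f,\lambda f\},\widehat h\}\in\Gamma\text{ for some }f\in\mathfrak H\}$, $\lambda\in\mathbb C\setminus\mathbb R$, called the Weyl function if it is operator-valued. With $\Gamma_0=\{\{\widehat f,h\}:\{\widehat f,\{h,h'\}\}\in\Gamma\}$ consider the conditions: (B1) $(\ast)$ holds on $\Gamma$; (B2) $\operatorname{ran}\Gamma_0=\mathcal H$; (B3) $\ker\Gamma_0$ is selfadjoint. *Boundary triplet.* $\{\mathcal H,\Gamma_0,\Gamma_1\}$ is an (ordinary) boundary triplet for $A^*$ if $\Gamma_0,\Gamma_1:A^*\to\mathcal H$ are linear, $(f',g)-(f,g')=(\Gamma_1\widehat f,\Gamma_0\widehat g)-(\Gamma_0\widehat f,\Gamma_1\widehat g)$ for $\widehat f,\widehat g\in A^*$, and $\{\Gamma_0,\Gamma_1\}:A^*\to\mathcal H^2$ is surjective. Its Weyl function is the $[\mathcal H]$-valued function $M$ with $\Gamma_1\widehat f=M(\lambda)\Gamma_0\widehat f$ for all $\widehat f=\{f,\lambda f\}\in A^*$, $\lambda\in\mathbb C\setminus\mathbb R$. *Nevanlinna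 families and pairs.* A family of linear relations $N(\lambda)$, $\lambda\in\mathbb C\setminus\mathbb R$, in $\mathcal H$ is a Nevanlinna family if $N(\lambda)$ is maximal dissipative (accumulative) for $\lambda\in\mathbb C_+$ ($\mathbb C_-$), $N(\lambda)^*=N(\bar\lambda)$, and for $\mu\in\mathbb C_+$ ($\mathbb C_-$) the function $(N(\lambda)+\mu)^{-1}\in[\mathcal H]$ is holomorphic in $\lambda\in\mathbb C_+$ ($\mathbb C_-$). It belongs to $R[\mathcal H]$ if in addition $\operatorname{dom}N(\lambda)=\mathcal H$ for all $\lambda$. A Nevanlinna pair is a pair of holomorphic functions $\Phi,\Psi:\mathbb C\setminus\mathbb R\to[\mathcal H]$ with $\operatorname{Im}(\Phi(\lambda)^*\Psi(\lambda))/\operatorname{Im}\lambda\ge0$, $\Psi(\bar\lambda)^*\Phi(\lambda)=\Phi(\bar\lambda)^*\Psi(\lambda)$, and $0\in\rho(\Psi(\lambda)\pm i\Phi(\lambda))$ for $\lambda\in\mathbb C_\pm$; it represents the family $\tau(\lambda)=\{\Phi(\lambda),\Psi(\lambda)\}:=\{\{\Phi(\lambda)h,\Psi(\lambda)h\}:h\in\mathcal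 H\}$. **Theorem.** Let $A$ and $S_2$ be symmetric linear relations (in particular, operators) in Hilbert spaces $\mathfrak H_1$ and $\mathfrak H_2$, let $\{\mathcal H,\Gamma_0,\Gamma_1\}$ be an ordinary boundary triplet for $A^*$, let $\chi:\mathfrak H_2^2\to\mathcal H^2$ be a boundary relation for $S_2^*$ with Weyl family $\tau$, and put $\widetilde{\mathfrak H}=\mathfrak H_1\oplus\mathfrak H_2$. (i) The linear relation $\Gamma^{coupl}:\widetilde{\mathfrak H}^2\to(\mathcal H\oplus\mathcal H)^2$, $$\Gamma^{coupl}=\left\{\left\{\widehat f_1\oplus\widehat f_2,\ \left\{\begin{pmatrix}h'+\Gamma_1\widehat f_1\\ h-\Gamma_0\widehat f_1\end{pmatrix},\begin{pmatrix}-\Gamma_0\widehat f_1\\ h'\end{pmatrix}\right\}\right\}:\ \widehat f_1\in A^*,\ \left\{\widehat f_2,\begin{pmatrix}h\\h'\end{pmatrix}\right\}\in\chi\right\},$$ is a boundary relation for $A^*\oplus S_2^*$ and satisfies (B1)–(B3). (ii) The Weyl family of $\Gamma^{coupl}$ is a Weyl function $M_{coupl}$ with values in $[\mathcal H\oplus\mathcal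 H]$; it belongs to $R[\mathcal H\oplus\mathcal H]$. If $M$ is the Weyl function of $\{\mathcal H,\Gamma_0,\Gamma_1\}$ and $\{\Phi,\Psi\}$ is a Nevanlinna pair with $\tau(\lambda)=\{\Phi(\lambda),\Psi(\lambda)\}$ for all $\lambda\in\mathbb C\setminus\mathbb R$, then for every $\lambda\in\mathbb C\setminus\mathbb R$ the operator $\Psi(\lambda)+M(\lambda)\Phi(\lambda)$ has an inverse in $[\mathcal H]$ and, at $\lambda$, $$M_{coupl}=\begin{pmatrix}-\Phi(\Psi+M\Phi)^{-1}& I-\Phi(\Psi+M\Phi)^{-1}M\\ \Psi(\Psi+M\Phi)^{-1}&\Psi(\Psi+M\Phi)^{-1}M\end{pmatrix}.$$ -/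

import Mathlib

open scoped ComplexConjugate

noncomputable section

namespace LinRel

variable {H : Type*} [NormedAddCommGroup H] [InnerProductSpace ℂ H]
variable {G : Type*} [NormedAddCommGroup G] [InnerProductSpace ℂ G]
variable {K : Type*} [NormedAddCommGroup K] [InnerProductSpace ℂ K]

/-! A linear relation from `X` to `Y` is a linear subspace of `X × Y`; a linear relation in `H`
is a subspace of `H × H`. The adjoint is `Submodule.adjoint`. The inner product of the literature,
linear in the first entry, is `(x, y) = inner ℂ y x`. Hilbert space orthogonal sums are
`WithLp 2 (H × G)`; the pairs `(f, f')` forming relations only use the product topology. -/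

/-- `{f, f'}` runs through `T` with `Im (f', f) = 0`. -/
def IsSymm (T : Submodule ℂ (H × H)) : Prop :=
  ∀ p ∈ T, (inner ℂ p.1 p.2).im = 0

def IsDissipative (T : Submodule ℂ (H × H)) : Prop :=
  ∀ p ∈ T, 0 ≤ (inner ℂ p.1 p.2).im

def IsAccumulative (T : Submodule ℂ (H × H)) : Prop :=
  ∀ p ∈ T, (inner ℂ p.1 p.2).im ≤ 0

/-- Dissipative, without proper dissipative extensions. -/
def IsMaxDissipative (T : Submodule ℂ (H × H)) : Prop :=
  IsDissipative T ∧ ∀ T' : Submodule ℂ (H × H), IsDissipative T' → T ≤ T' → T' = T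

/-- Accumulative, without proper accumulative extensions. -/
def IsMaxAccumulative (T : Submodule ℂ (H × H)) : Prop :=
  IsAccumulative T ∧ ∀ T' : Submodule ℂ (H × H), IsAccumulative T' → T ≤ T' → T' = T

def IsSelfAdj (T : Submodule ℂ (H × H)) : Prop := T.adjoint = T

/-- The graph of a bounded operator, as a linear relation. -/
def graph (B : H →L[ℂ] H) : Submodule ℂ (H × H) := LinearMap.graph (B : H →ₗ[ℂ] H)

/-- The relation `(T + μ)⁻¹ = {{h' + μ h, h} : {h, h'} ∈ T}`. -/
def shiftInv (T : Submodule ℂ (H × H)) (μ : ℂ) : Submodule ℂ (H × H) :=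
  T.map ((LinearMap.snd ℂ H H + μ • LinearMap.fst ℂ H H).prod (LinearMap.fst ℂ H H))

/-- The componentwise orthogonal sum
`R ⊕ R' = {{f₁ ⊕ f₂, f₁' ⊕ f₂'} : {f₁, f₁'} ∈ R, {f₂, f₂'} ∈ R'}`. -/
def orthSum (R : Submodule ℂ (H × H)) (R' : Submodule ℂ (G × G)) :
    Submodule ℂ (WithLp 2 (H × G) × WithLp 2 (H × G)) where
  carrier := {p | (p.1.fst, p.2.fst) ∈ R ∧ (p.1.snd, p.2.snd) ∈ R'}
  add_mem' := fun ha hb => ⟨R.add_mem ha.1 hb.1, R'.add_mem ha.2 hb.2⟩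
  zero_mem' := ⟨R.zero_mem, R'.zero_mem⟩
  smul_mem' := fun c _ ha => ⟨R.smul_mem c ha.1, R'.smul_mem c ha.2⟩

/-- The nonreal numbers, on which Nevanlinna functions are considered. -/
def nonreal : Set ℂ := {z | z.im ≠ 0}

/-- Nevanlinna families in `K`; only the values at nonreal points matter. -/
structure IsNevanlinnaFamily (M : ℂ → Submodule ℂ (K × K)) : Prop where
  maxDissipative : ∀ z : ℂ, 0 < z.im → IsMaxDissipative (M z)
  maxAccumulative : ∀ z : ℂ, z.im < 0 → IsMaxAccumulative (M z)
  adjoint_eq : ∀ z ∈ nonreal, (M z).adjoint = M (conj z)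
  holo_upper : ∀ μ : ℂ, 0 < μ.im → ∃ R : ℂ → K →L[ℂ] K,
    DifferentiableOn ℂ R {z | 0 < z.im} ∧ ∀ z : ℂ, 0 < z.im → shiftInv (M z) μ = graph (R z)
  holo_lower : ∀ μ : ℂ, μ.im < 0 → ∃ R : ℂ → K →L[ℂ] K,
    DifferentiableOn ℂ R {z | z.im < 0} ∧ ∀ z : ℂ, z.im < 0 → shiftInv (M z) μ = graph (R z)

/-- The class `R[K]`: Nevanlinna families with `dom M(λ) = K` for all nonreal `λ`. -/
def IsClassR (M : ℂ → Submodule ℂ (K × K)) : Prop :=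
  IsNevanlinnaFamily M ∧ ∀ z ∈ nonreal, ∀ h : K, ∃ h' : K, (h, h') ∈ M z

/-- Nevanlinna pairs of holomorphic functions with values in the bounded operators. -/
structure IsNevanlinnaPair [CompleteSpace K] (Φ Ψ : ℂ → K →L[ℂ] K) : Prop where
  holo_left : DifferentiableOn ℂ Φ nonreal
  holo_right : DifferentiableOn ℂ Ψ nonreal
  /-- `Im (Φ(λ)* Ψ(λ)) / Im λ ≥ 0` as a quadratic form. -/
  nonneg : ∀ z ∈ nonreal, ∀ x : K, 0 ≤ (inner ℂ (Φ z x) (Ψ z x)).im / z.im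
  symm : ∀ z ∈ nonreal, ContinuousLinearMap.adjoint (Ψ (conj z)) ∘L Φ z
    - ContinuousLinearMap.adjoint (Φ (conj z)) ∘L Ψ z = 0
  invertible_upper : ∀ z : ℂ, 0 < z.im → IsUnit (Ψ z + Complex.I • Φ z)
  invertible_lower : ∀ z : ℂ, z.im < 0 → IsUnit (Ψ z - Complex.I • Φ z)

/-- The relation `{Φ, Ψ} = {{Φ h, Ψ h} : h ∈ K}`. -/
def pairRel (Φ Ψ : K →L[ℂ] K) : Submodule ℂ (K × K) :=
  LinearMap.range ((Φ : K →ₗ[ℂ] K).prod (Ψ : K →ₗ[ℂ] K))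

/-- Green's identity `(f', g) - (f, g') = (h', k) - (h, k')` for two elements
`{f, f', h, h'}` and `{g, g', k, k'}` of `H² × K²`. -/
def GreenAt (p q : (H × H) × (K × K)) : Prop :=
  inner ℂ q.1.1 p.1.2 - inner ℂ q.1.2 p.1.1 = inner ℂ q.2.1 p.2.2 - inner ℂ q.2.2 p.2.1

/-- `Γ : H² → K²` is a boundary relation for `R`, where `R = S*` is the adjoint of a closed
symmetric linear relation `S` (then `S = R*`). -/
structure IsBoundaryRelation (R : Submodule ℂ (H × H))
    (Γ : Submodule ℂ ((H × H) × (K × K))) : Prop where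
  isAdjoint : ∃ S : Submodule ℂ (H × H), IsClosed (S : Set (H × H)) ∧ IsSymm S ∧ S.adjoint = R
  dom_le : ∀ p ∈ Γ, p.1 ∈ R
  dom_dense : ∀ f ∈ R, f ∈ closure {g : H × H | ∃ h : K × K, (g, h) ∈ Γ}
  green : ∀ p ∈ Γ, ∀ q ∈ Γ, GreenAt p q
  maximal : ∀ q : (H × H) × (K × K), (∀ p ∈ Γ, GreenAt p q) → q ∈ Γ

/-- The Weyl family `λ ↦ {ĥ : {{f, λ f}, ĥ} ∈ Γ for some f}` of a relation `Γ : H² → K²`. -/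
def weylFamily (Γ : Submodule ℂ ((H × H) × (K × K))) (z : ℂ) : Submodule ℂ (K × K) where
  carrier := {h | ∃ f : H, ((f, z • f), h) ∈ Γ}
  add_mem' := by
    rintro a b ⟨f, hf⟩ ⟨g, hg⟩
    exact ⟨f + g, by simpa using Γ.add_mem hf hg⟩
  zero_mem' := ⟨0, by rw [smul_zero]; exact Γ.zero_mem⟩
  smul_mem' := by
    rintro c a ⟨f, hf⟩
    exact ⟨c • f, by simpa [smul_comm z c f] using Γ.smul_mem c hf⟩

/-- `ker Γ₀`, where `Γ₀ = {{f̂, h} : {f̂, {h, h'}} ∈ Γ}`. -/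
def kerZero (Γ : Submodule ℂ ((H × H) × (K × K))) : Submodule ℂ (H × H) where
  carrier := {f | ∃ h' : K, (f, ((0 : K), h')) ∈ Γ}
  add_mem' := by
    rintro a b ⟨f, hf⟩ ⟨g, hg⟩
    exact ⟨f + g, by simpa using Γ.add_mem hf hg⟩
  zero_mem' := ⟨0, Γ.zero_mem⟩
  smul_mem' := by
    rintro c a ⟨f, hf⟩
    exact ⟨c • f, by simpa using Γ.smul_mem c hf⟩

/-- Green's identity, surjectivity of `Γ₀`, and selfadjointness of `ker Γ₀`. -/
structure SatisfiesB (Γ : Submodule ℂ ((H × H) × (K × K))) : Prop where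
  green : ∀ p ∈ Γ, ∀ q ∈ Γ, GreenAt p q
  ran_zero : ∀ h : K, ∃ (f : H × H) (h' : K), (f, (h, h')) ∈ Γ
  ker_zero : IsSelfAdj (kerZero Γ)

/-- `{K, Γ₀, Γ₁}` is an (ordinary) boundary triplet for `A*`. -/
structure IsBoundaryTriplet (A : Submodule ℂ (H × H)) (Γ₀ Γ₁ : A.adjoint →ₗ[ℂ] K) : Prop where
  green : ∀ f g : A.adjoint, inner ℂ g.1.1 f.1.2 - inner ℂ g.1.2 f.1.1
    = inner ℂ (Γ₀ g) (Γ₁ f) - inner ℂ (Γ₁ g) (Γ₀ f)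
  surjective : ∀ h h' : K, ∃ f : A.adjoint, Γ₀ f = h ∧ Γ₁ f = h'

/-- `M` is the Weyl function of the boundary triplet: `Γ₁ f̂ = M(λ) Γ₀ f̂` for all
`f̂ = {f, λ f} ∈ A*` and nonreal `λ`. -/
def IsWeylFunction (A : Submodule ℂ (H × H)) (Γ₀ Γ₁ : A.adjoint →ₗ[ℂ] K)
    (M : ℂ → K →L[ℂ] K) : Prop :=
  ∀ z ∈ nonreal, ∀ f : A.adjoint, f.1.2 = z • f.1.1 → Γ₁ f = M z (Γ₀ f)

/-- The coupling: all `{f̂₁ ⊕ f̂₂, (h' + Γ₁ f̂₁, h - Γ₀ f̂₁) ⊕ (-Γ₀ f̂₁, h')}` with `f̂₁ ∈ A*` and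
`{f̂₂, (h, h')} ∈ χ`. -/
def couplRel (A : Submodule ℂ (H × H)) (Γ₀ Γ₁ : A.adjoint →ₗ[ℂ] K)
    (χ : Submodule ℂ ((G × G) × (K × K))) :
    Submodule ℂ ((WithLp 2 (H × G) × WithLp 2 (H × G)) ×
      (WithLp 2 (K × K) × WithLp 2 (K × K))) where
  carrier := {p | ∃ (f : A.adjoint) (g g' : G) (h h' : K), ((g, g'), (h, h')) ∈ χ ∧
    p = ((WithLp.toLp 2 (f.1.1, g), WithLp.toLp 2 (f.1.2, g')),
      (WithLp.toLp 2 (h' + Γ₁ f, h - Γ₀ f), WithLp.toLp 2 (-Γ₀ f, h')))}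
  add_mem' := by
    rintro _ _ ⟨f, g, g', h, h', hm, rfl⟩ ⟨f₂, g₂, g₂', h₂, h₂', hm₂, rfl⟩
    refine ⟨f + f₂, g + g₂, g' + g₂', h + h₂, h' + h₂', χ.add_mem hm hm₂, ?_⟩
    simp only [Prod.mk_add_mk, ← WithLp.toLp_add, map_add, Submodule.coe_add, Prod.fst_add,
      Prod.snd_add, neg_add]
    rw [add_add_add_comm h' h₂', add_sub_add_comm]
  zero_mem' := ⟨0, 0, 0, 0, 0, χ.zero_mem, by simp; rfl⟩
  smul_mem' := by
    rintro c _ ⟨f, g, g', h, h', hm, rfl⟩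
    refine ⟨c • f, c • g, c • g', c • h, c • h', χ.smul_mem c hm, ?_⟩
    simp [← WithLp.toLp_smul, smul_sub]

/-- The bounded operator on `K ⊕ K` with block matrix `(a b; c d)`. -/
def blockOp (a b c d : K →L[ℂ] K) : WithLp 2 (K × K) →L[ℂ] WithLp 2 (K × K) :=
  ((WithLp.prodContinuousLinearEquiv 2 ℂ K K).symm : K × K →L[ℂ] WithLp 2 (K × K)) ∘L
    (((a.coprod b).prod (c.coprod d)) ∘L
      (WithLp.prodContinuousLinearEquiv 2 ℂ K K : WithLp 2 (K × K) →L[ℂ] K × K))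

end LinRel

end

/-!
The boundary triplet and the boundary relation `χ` are both maximal for Green's identity, and the
coupling arises from their orthogonal sum by a change of the boundary values that preserves the
right-hand side of Green's identity. Green's identity for the coupling is a direct computation
(`LinRel.greenAt_couplRel`). For maximality (`LinRel.couplRel_maximal`) an element satisfying
Green's identity against the coupling is tested separately against the elements with zero
component in `χ` and with zero component in `A*`: the maximality of the triplet
(`LinRel.IsBoundaryTriplet.exists_of_green`) and that of `χ` recover its two components. Since the
triplet maps `A*` onto `K × K`, every value of `Γ₀` of the coupling is attained already over
`A*`, and every element of `χ` can be completed to an element of the kernel of `Γ₀`; the latter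
makes this kernel selfadjoint (`LinRel.satisfiesB_couplRel`).

The properties of the Weyl family hold for every `Γ` that satisfies Green's identity, has
`ran Γ₀ = K` and has `ker Γ₀ = T` selfadjoint. From `ran (T - z) = H`
(`LinRel.IsSelfAdj.exists_sub_smul_eq`) each `h` in `K` is the `Γ₀`-value of a unique `{γ h, z γ h}`,
with a unique `Γ₁`-value `M h`; Green's identity provides an everywhere defined formal adjoint of
`M(z)`, namely `M(z̄)`, so that `M(z)` is bounded, and `Im (M h, h) = Im z ‖γ h‖²`
(`LinRel.SatisfiesB.exists_isWeylPair`). The identity `M(z) - M(w) = (z - w) γ(w̄)* γ(z)` and the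
norm continuity of `γ` give holomorphy, and the class `R` follows
(`LinRel.SatisfiesB.isClassR_graph`).

The block formula is linear algebra (`LinRel.weylFunction_couplRel_eq`): over `z`, the boundary
values of the coupling are `{(Ψ x + M u, Φ x - u), (-u, Ψ x)}` with `x` and `u` arbitrary. That they
form the graph of an everywhere defined operator makes `Ψ + M Φ` bijective, and the formula
results from solving for `x` and `u`.
-/

noncomputable section

namespace LinRel

open Filter Topology

variable {H : Type*} [NormedAddCommGroup H] [InnerProductSpace ℂ H]
variable {G : Type*} [NormedAddCommGroup G] [InnerProductSpace ℂ G]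
variable {K : Type*} [NormedAddCommGroup K] [InnerProductSpace ℂ K]

/-! ### Adjoints and symmetry of linear relations -/

theorem inner_self_eq_ofReal (x : H) : inner ℂ x x = ((‖x‖ ^ 2 : ℝ) : ℂ) := by
  rw [inner_self_eq_norm_sq_to_K]
  push_cast
  rfl

theorem mem_adjoint_iff_inner_eq {T : Submodule ℂ (H × H)} {x : H × H} :
    x ∈ T.adjoint ↔ ∀ p ∈ T, inner ℂ p.2 x.1 = inner ℂ p.1 x.2 := by
  simp only [Submodule.mem_adjoint_iff, sub_eq_zero, Prod.forall]

theorem IsSymm.inner_eq {T : Submodule ℂ (H × H)} (hT : IsSymm T) {p q : H × H}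
    (hp : p ∈ T) (hq : q ∈ T) : inner ℂ p.2 q.1 = inner ℂ p.1 q.2 := by
  -- polarization: compare the vanishing imaginary parts at `p + q` and `p + i q`
  have h1 := hT _ hp
  have h2 := hT _ hq
  have h3 := hT _ (T.add_mem hp hq)
  have h4 := hT _ (T.add_mem hp (T.smul_mem Complex.I hq))
  rw [← inner_conj_symm p.2 q.1]
  simp only [Prod.fst_add, Prod.snd_add, Prod.smul_fst, Prod.smul_snd, inner_add_left,
    inner_add_right, inner_smul_left, inner_smul_right, Complex.add_im, Complex.mul_im,
    Complex.mul_re, Complex.add_re, Complex.conj_I, Complex.neg_re, Complex.neg_im, Complex.I_re,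
    Complex.I_im] at h1 h2 h3 h4
  apply Complex.ext
  · simp only [Complex.conj_re]
    linarith
  · simp only [Complex.conj_im]
    linarith

theorem IsSymm.le_adjoint {T : Submodule ℂ (H × H)} (hT : IsSymm T) : T ≤ T.adjoint :=
  fun _ hx => mem_adjoint_iff_inner_eq.2 fun _ hp => hT.inner_eq hp hx

theorem IsSelfAdj.isSymm {T : Submodule ℂ (H × H)} (hT : IsSelfAdj T) : IsSymm T := by
  intro p hp
  have h : p ∈ T.adjoint := by rw [hT]; exact hp
  have h := mem_adjoint_iff_inner_eq.1 h p hp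
  rw [← inner_conj_symm] at h
  exact Complex.conj_eq_iff_im.1 h

theorem isClosed_adjoint (T : Submodule ℂ (H × H)) : IsClosed (T.adjoint : Set (H × H)) := by
  have h : (T.adjoint : Set (H × H)) =
      ⋂ p ∈ T, {x : H × H | inner ℂ p.2 x.1 = inner ℂ p.1 x.2} := by
    ext x
    simp only [SetLike.mem_coe, mem_adjoint_iff_inner_eq, Set.mem_iInter, Set.mem_ofPred_eq]
  rw [h]
  exact isClosed_biInter fun p _ => isClosed_eq (by fun_prop) (by fun_prop)

theorem adjoint_topologicalClosure (T : Submodule ℂ (H × H)) :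
    T.topologicalClosure.adjoint = T.adjoint := by
  ext x
  simp only [mem_adjoint_iff_inner_eq]
  refine ⟨fun h p hp => h p (T.le_topologicalClosure hp), fun h p hp => ?_⟩
  have hc : IsClosed {p : H × H | inner ℂ p.2 x.1 = inner ℂ p.1 x.2} :=
    isClosed_eq (by fun_prop) (by fun_prop)
  exact closure_minimal (fun p hp => h p hp) hc hp

theorem IsSymm.topologicalClosure {T : Submodule ℂ (H × H)} (hT : IsSymm T) :
    IsSymm T.topologicalClosure := by
  intro p hp
  have hc : IsClosed {p : H × H | (inner ℂ p.1 p.2).im = 0} :=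
    isClosed_eq (by fun_prop) (by fun_prop)
  exact closure_minimal (fun p hp => hT p hp) hc hp

/-- The lower bound `|Im z| ‖f‖ ≤ ‖f' - z f‖` on a symmetric relation. -/
theorem IsSymm.abs_im_mul_norm_le {T : Submodule ℂ (H × H)} (hT : IsSymm T) (z : ℂ) {p : H × H}
    (hp : p ∈ T) : |z.im| * ‖p.1‖ ≤ ‖p.2 - z • p.1‖ := by
  have h1 : (inner ℂ p.1 (p.2 - z • p.1)).im = -(z.im * ‖p.1‖ ^ 2) := by
    rw [inner_sub_right, inner_smul_right, inner_self_eq_ofReal, Complex.sub_im, hT p hp,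
      Complex.im_mul_ofReal, zero_sub]
  have h2 : |z.im| * ‖p.1‖ ^ 2 ≤ ‖p.1‖ * ‖p.2 - z • p.1‖ := by
    calc |z.im| * ‖p.1‖ ^ 2 = |(inner ℂ p.1 (p.2 - z • p.1)).im| := by
          rw [h1, abs_neg, abs_mul, abs_of_nonneg (sq_nonneg ‖p.1‖)]
      _ ≤ ‖inner ℂ p.1 (p.2 - z • p.1)‖ := Complex.abs_im_le_norm _
      _ ≤ _ := norm_inner_le_norm _ _
  rcases (norm_nonneg p.1).eq_or_lt with h | h
  · rw [← h, mul_zero]; exact norm_nonneg _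
  · nlinarith

/-- A selfadjoint relation satisfies `ran (T - z) = H` at every nonreal `z`: the range is closed
by the lower bound, and a vector `g` orthogonal to it gives `{g, z̄ g} ∈ T* = T`. -/
theorem IsSelfAdj.exists_sub_smul_eq [CompleteSpace H] {T : Submodule ℂ (H × H)}
    (hT : IsSelfAdj T) {z : ℂ} (hz : z ∈ nonreal) (y : H) :
    ∃ p ∈ T, p.2 - z • p.1 = y := by
  have hz0 : 0 < |z.im| := abs_pos.2 hz
  let L : H × H →L[ℂ] H := ContinuousLinearMap.snd ℂ H H - z • ContinuousLinearMap.fst ℂ H H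
  have hL (p : H × H) : L p = p.2 - z • p.1 := rfl
  have hTc : IsClosed (T : Set (H × H)) := hT ▸ isClosed_adjoint T
  have : CompleteSpace T := hTc.completeSpace_coe
  have hb (p : T) : ‖p‖ ≤ (1 + (1 + ‖z‖) / |z.im|) * ‖(L ∘L T.subtypeL) p‖ := by
    have h1 := hT.isSymm.abs_im_mul_norm_le z p.2
    set r := ‖(L ∘L T.subtypeL) p‖ with hr
    have h1 : ‖p.1.1‖ ≤ r / |z.im| := by
      rw [le_div_iff₀ hz0, mul_comm]; exact h1
    have hr0 : 0 ≤ r := norm_nonneg _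
    have h3 : ‖p.1.2‖ ≤ r + ‖z‖ * ‖p.1.1‖ := by
      calc ‖p.1.2‖ = ‖L p.1 + z • p.1.1‖ := by rw [hL, sub_add_cancel]
        _ ≤ r + ‖z‖ * ‖p.1.1‖ := (norm_add_le _ _).trans_eq (by rw [norm_smul]; rfl)
    have h4 : ‖z‖ * ‖p.1.1‖ ≤ ‖z‖ * (r / |z.im|) := by gcongr
    have h5 : 0 ≤ r / |z.im| := by positivity
    have h6 : 0 ≤ ‖z‖ * (r / |z.im|) := by positivity
    have h7 : (1 + (1 + ‖z‖) / |z.im|) * r = r + r / |z.im| + ‖z‖ * (r / |z.im|) := by ring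
    rw [h7]
    change max ‖p.1.1‖ ‖p.1.2‖ ≤ _
    exact max_le (by linarith) (by linarith)
  have hcl : IsClosed (Set.range (L ∘L T.subtypeL)) := by
    have ha : AntilipschitzWith (⟨1 + (1 + ‖z‖) / |z.im|, by positivity⟩ : NNReal)
        (L ∘L T.subtypeL) :=
      AddMonoidHomClass.antilipschitz_of_bound _ hb
    exact ha.isClosed_range (L ∘L T.subtypeL).uniformContinuous
  set R : Submodule ℂ H := ((L ∘L T.subtypeL : T →L[ℂ] H) : T →ₗ[ℂ] H).range with hR
  have hRc : IsClosed (R : Set H) := by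
    exact hcl
  have : CompleteSpace R := hRc.completeSpace_coe
  have hbot : Rᗮ = ⊥ := by
    refine (Submodule.eq_bot_iff _).2 fun g hg => ?_
    have hmem : (g, conj z • g) ∈ T := by
      rw [← hT, mem_adjoint_iff_inner_eq]
      intro p hp
      have h := (Submodule.mem_orthogonal _ _).1 hg (p.2 - z • p.1) ⟨⟨p, hp⟩, rfl⟩
      rwa [inner_sub_left, inner_smul_left, sub_eq_zero, ← inner_smul_right] at h
    have h := hT.isSymm.abs_im_mul_norm_le (conj z) hmem
    simp only [sub_self, norm_zero, Complex.conj_im, abs_neg] at h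
    have : ‖g‖ ≤ 0 := by nlinarith
    simpa using this
  have htop : R = ⊤ := (Submodule.orthogonal_eq_bot_iff).1 hbot
  obtain ⟨p, hp⟩ : y ∈ R := htop ▸ Submodule.mem_top
  exact ⟨p.1, p.2, hp⟩

/-! ### Graphs of bounded operators as linear relations -/

theorem mem_graph_iff {B : K →L[ℂ] K} {x : K × K} : x ∈ graph B ↔ x.2 = B x.1 := by
  simp [graph, LinearMap.mem_graph_iff]

theorem adjoint_graph {B C : K →L[ℂ] K}
    (h : ∀ x y, inner ℂ x (B y) = inner ℂ (C x) y) : (graph B).adjoint = graph C := by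
  ext x
  rw [mem_adjoint_iff_inner_eq, mem_graph_iff]
  constructor
  · intro hx
    refine ext_inner_left ℂ fun v => ?_
    have h1 := hx (v, B v) (mem_graph_iff.2 rfl)
    simp only at h1
    rw [← h1, ← inner_conj_symm, h, inner_conj_symm]
  · intro hx p hp
    rw [mem_graph_iff.1 hp, hx, ← inner_conj_symm, h, inner_conj_symm]

/-- An everywhere defined dissipative operator has no proper dissipative extension: a pair `(0, u)`
in an extension forces `Im (B k + c u, k) ≥ 0` for all `c` and `k`. -/
theorem isMaxDissipative_graph {B : K →L[ℂ] K} (hB : ∀ h, 0 ≤ (inner ℂ h (B h)).im) :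
    IsMaxDissipative (graph B) := by
  refine ⟨fun p hp => by rw [mem_graph_iff.1 hp]; exact hB _, fun T hT hle => ?_⟩
  refine le_antisymm (fun x hx => mem_graph_iff.2 ?_) hle
  set u := x.2 - B x.1 with hu
  have hu0 : ((0 : K), u) ∈ T := by
    have h := T.sub_mem hx (hle (mem_graph_iff.2 (rfl : (x.1, B x.1).2 = _)))
    convert h using 1
    ext <;> simp [hu]
  -- take `k = u` and a large negative multiple of `i u`
  have key : ‖u‖ ^ 2 = 0 := by
    by_contra hne
    have hpos : 0 < ‖u‖ ^ 2 := lt_of_le_of_ne (by positivity) (Ne.symm hne)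
    set a := (inner ℂ u (B u)).im with ha
    have h := hT _ (T.add_mem (hle (mem_graph_iff.2 (rfl : (u, B u).2 = _)))
      (T.smul_mem (((-(a + 1) / ‖u‖ ^ 2 : ℝ) : ℂ) * Complex.I) hu0))
    simp only [Prod.smul_mk, smul_zero, Prod.mk_add_mk, add_zero, inner_add_right,
      inner_smul_right, inner_self_eq_ofReal, Complex.add_im] at h
    rw [← ha] at h
    have h2 : ((((-(a + 1) / ‖u‖ ^ 2 : ℝ) : ℂ) * Complex.I) * ((‖u‖ ^ 2 : ℝ) : ℂ)).im
        = -(a + 1) := by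
      rw [Complex.im_mul_ofReal, Complex.im_ofReal_mul, Complex.I_im, mul_one,
        div_mul_cancel₀ _ hne]
    rw [h2] at h
    linarith
  have : u = 0 := by simpa using key
  exact sub_eq_zero.1 this

theorem isMaxAccumulative_graph {B : K →L[ℂ] K} (hB : ∀ h, (inner ℂ h (B h)).im ≤ 0) :
    IsMaxAccumulative (graph B) := by
  -- `{h, h'} ↦ {h, -h'}` interchanges accumulative and dissipative relations
  let e : (K × K) →ₗ[ℂ] (K × K) := (LinearMap.fst ℂ K K).prod (-LinearMap.snd ℂ K K)
  have he (x : K × K) : e x = (x.1, -x.2) := rfl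
  refine ⟨fun p hp => by rw [mem_graph_iff.1 hp]; exact hB _, fun T hT hle => ?_⟩
  have h := (isMaxDissipative_graph (B := -B) (fun h => by simpa using hB h)).2 (T.comap e)
    (fun p hp => by simpa [he] using hT _ (Submodule.mem_comap.1 hp))
    (fun p hp => Submodule.mem_comap.2 (hle (mem_graph_iff.2 (by
      rw [he]; simp [mem_graph_iff.1 hp]))))
  refine le_antisymm (fun x hx => mem_graph_iff.2 ?_) hle
  have hx' : (x.1, -x.2) ∈ T.comap e := by
    rw [Submodule.mem_comap, he]; simpa using hx
  rw [h] at hx'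
  simpa using mem_graph_iff.1 hx'

theorem shiftInv_graph {B : K →L[ℂ] K} {μ : ℂ} (h : IsUnit (B + μ • (1 : K →L[ℂ] K))) :
    shiftInv (graph B) μ = graph (Ring.inverse (B + μ • (1 : K →L[ℂ] K))) := by
  ext x
  rw [mem_graph_iff, shiftInv, Submodule.mem_map]
  constructor
  · rintro ⟨p, hp, rfl⟩
    have h1 := DFunLike.congr_fun (Ring.inverse_mul_cancel _ h) p.1
    simp only [mul_apply_eq_comp, add_apply, smul_apply,
      one_apply_eq_self] at h1
    rw [← mem_graph_iff.1 hp] at h1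
    simpa using h1.symm
  · intro hx
    refine ⟨(x.2, B x.2), mem_graph_iff.2 rfl, ?_⟩
    have h1 := DFunLike.congr_fun (Ring.mul_inverse_cancel _ h) x.1
    simp only [mul_apply_eq_comp, add_apply, smul_apply,
      one_apply_eq_self] at h1
    rw [← hx] at h1
    exact Prod.ext h1 rfl

theorem isUnit_of_mul_norm_sq_le_abs_im [CompleteSpace K] {B : K →L[ℂ] K} {c : ℝ} (hc : 0 < c)
    (hB : ∀ x, c * ‖x‖ ^ 2 ≤ |(inner ℂ x (B x)).im|) : IsUnit B := by
  refine ContinuousLinearMap.isUnit_of_forall_le_norm_inner_map B (c := ⟨c, hc.le⟩) hc fun x => ?_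
  rw [← inner_conj_symm, RCLike.norm_conj, mul_comm]
  exact (hB x).trans (Complex.abs_im_le_norm _)

/-! ### The Weyl function of a boundary relation with selfadjoint kernel -/

/-- The defining property of the values at `z` of the Weyl function `M` and of the `γ`-field. -/
def IsWeylPair (Γ : Submodule ℂ ((H × H) × (K × K))) (z : ℂ) (M : K →L[ℂ] K) (γ : K →L[ℂ] H) :
    Prop :=
  ∀ h, ((γ h, z • γ h), (h, M h)) ∈ Γ

namespace SatisfiesB

variable {Γ : Submodule ℂ ((H × H) × (K × K))}

/-- The function `M(z)` is single-valued and `γ(z)` is an operator: an element over `h = 0` lies in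
`ker Γ₀`, which has no nonreal eigenvalue, and Green's identity with `ran Γ₀ = K` does the rest. -/
theorem eq_zero_of_mem (hΓ : SatisfiesB Γ) {z : ℂ} (hz : z ∈ nonreal) {f : H} {h' : K}
    (h : ((f, z • f), ((0 : K), h')) ∈ Γ) : f = 0 ∧ h' = 0 := by
  have hf : f = 0 := by
    have h1 := hΓ.ker_zero.isSymm.abs_im_mul_norm_le z (p := (f, z • f)) ⟨h', h⟩
    simp only [sub_self, norm_zero] at h1
    have h2 : 0 < |z.im| := abs_pos.2 hz
    have : ‖f‖ ≤ 0 := by nlinarith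
    simpa using this
  refine ⟨hf, ext_inner_left ℂ fun k => ?_⟩
  obtain ⟨g, k', hg⟩ := hΓ.ran_zero k
  have h1 := hΓ.green _ h _ hg
  simpa [GreenAt, hf] using h1.symm

theorem exists_mem [CompleteSpace H] (hΓ : SatisfiesB Γ) {z : ℂ} (hz : z ∈ nonreal) (h : K) :
    ∃ (f : H) (h' : K), ((f, z • f), (h, h')) ∈ Γ := by
  obtain ⟨⟨f, f'⟩, h', hf⟩ := hΓ.ran_zero h
  -- correct `{f, f'}` by an element of `ker Γ₀`
  obtain ⟨⟨g, g'⟩, ⟨k', hg⟩, hgz⟩ := hΓ.ker_zero.exists_sub_smul_eq hz (f' - z • f)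
  refine ⟨f - g, h' - k', ?_⟩
  have h1 := Γ.sub_mem hf hg
  have h2 : z • (f - g) = f' - g' := by
    simp only at hgz
    rw [smul_sub, sub_eq_sub_iff_sub_eq_sub, ← neg_sub f' (z • f), ← hgz, neg_sub]
  rw [h2]
  simpa using h1

theorem green_of_mem (hΓ : SatisfiesB Γ) {z w : ℂ} {f g : H} {h h' k k' : K}
    (hf : ((f, z • f), (h, h')) ∈ Γ) (hg : ((g, w • g), (k, k')) ∈ Γ) :
    (z - conj w) * inner ℂ g f = inner ℂ k h' - inner ℂ k' h := by
  have h1 := hΓ.green _ hf _ hg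
  simp only [GreenAt, inner_smul_left, inner_smul_right] at h1
  rw [← h1, sub_mul]

theorem exists_isWeylPair [CompleteSpace H] [CompleteSpace K] (hΓ : SatisfiesB Γ) {z : ℂ}
    (hz : z ∈ nonreal) : ∃ (M : K →L[ℂ] K) (γ : K →L[ℂ] H), IsWeylPair Γ z M γ := by
  have hzc : conj z ∈ nonreal := by simpa [nonreal] using hz
  choose f h' hf using hΓ.exists_mem hz
  choose g k' hg using hΓ.exists_mem hzc
  have huniq {a b : H} {h c d : K} (h1 : ((a, z • a), (h, c)) ∈ Γ)
      (h2 : ((b, z • b), (h, d)) ∈ Γ) : a = b ∧ c = d := by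
    have h3 := hΓ.eq_zero_of_mem hz (f := a - b) (h' := c - d)
      (by simpa [smul_sub] using Γ.sub_mem h1 h2)
    exact ⟨sub_eq_zero.1 h3.1, sub_eq_zero.1 h3.2⟩
  have hadd (x y : K) : f (x + y) = f x + f y ∧ h' (x + y) = h' x + h' y :=
    huniq (hf _) (by simpa using Γ.add_mem (hf x) (hf y))
  have hsmul (c : ℂ) (x : K) : f (c • x) = c • f x ∧ h' (c • x) = c • h' x :=
    huniq (hf _) (by simpa [smul_comm z c] using Γ.smul_mem c (hf x))
  let M₀ : K →ₗ[ℂ] K :=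
    { toFun := h', map_add' := fun x y => (hadd x y).2, map_smul' := fun c x => (hsmul c x).2 }
  let γ₀ : K →ₗ[ℂ] H :=
    { toFun := f, map_add' := fun x y => (hadd x y).1, map_smul' := fun c x => (hsmul c x).1 }
  have hadj (x k : K) : inner ℂ k (M₀ x) = inner ℂ (k' k) x := by
    have h1 := hΓ.green_of_mem (hf x) (hg k)
    rw [Complex.conj_conj, sub_self, zero_mul] at h1
    exact (sub_eq_zero.1 h1.symm)
  -- `M₀` has an everywhere defined formal adjoint, hence a closed graph
  have hM₀ : Continuous M₀ := by
    refine M₀.continuous_of_seq_closed_graph fun u x y hu hy => ext_inner_left ℂ fun k => ?_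
    have h1 : Tendsto (fun n => inner ℂ k (M₀ (u n))) atTop (𝓝 (inner ℂ k y)) :=
      tendsto_const_nhds.inner hy
    have h2 : Tendsto (fun n => inner ℂ (k' k) (u n)) atTop (𝓝 (inner ℂ (k' k) x)) :=
      tendsto_const_nhds.inner hu
    rw [hadj]
    refine tendsto_nhds_unique h1 ?_
    simpa only [hadj] using h2
  let M : K →L[ℂ] K := ⟨M₀, hM₀⟩
  -- `Im z ‖γ h‖² = Im (M h, h)` bounds `γ`
  have hz0 : 0 < |z.im| := abs_pos.2 hz
  have hγ (x : K) : ‖γ₀ x‖ ≤ √(‖M‖ / |z.im|) * ‖x‖ := by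
    have h1 := congrArg Complex.im (hΓ.green_of_mem (hf x) (hf x))
    rw [inner_self_eq_ofReal, Complex.im_mul_ofReal, ← inner_conj_symm (h' x) x] at h1
    simp only [Complex.sub_im, Complex.conj_im, sub_neg_eq_add] at h1
    have h2 : |z.im| * ‖f x‖ ^ 2 ≤ ‖M‖ * ‖x‖ ^ 2 := by
      calc |z.im| * ‖f x‖ ^ 2 = |(inner ℂ x (h' x)).im| := by
            rw [show (inner ℂ x (h' x)).im = z.im * ‖f x‖ ^ 2 by linarith, abs_mul,
              abs_of_nonneg (sq_nonneg ‖f x‖)]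
        _ ≤ ‖inner ℂ x (M x)‖ := Complex.abs_im_le_norm _
        _ ≤ ‖x‖ * ‖M x‖ := norm_inner_le_norm _ _
        _ ≤ ‖x‖ * (‖M‖ * ‖x‖) := by gcongr; exact M.le_opNorm x
        _ = ‖M‖ * ‖x‖ ^ 2 := by ring
    refine le_of_pow_le_pow_left₀ two_ne_zero (by positivity) ?_
    rw [mul_pow, Real.sq_sqrt (by positivity), div_mul_eq_mul_div, le_div_iff₀ hz0, mul_comm]
    exact h2
  exact ⟨M, γ₀.mkContinuous _ hγ, hf⟩

theorem weylFamily_eq_graph (hΓ : SatisfiesB Γ) {z : ℂ} (hz : z ∈ nonreal) {M : K →L[ℂ] K}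
    {γ : K →L[ℂ] H} (hM : IsWeylPair Γ z M γ) : weylFamily Γ z = graph M := by
  ext ⟨h, h'⟩
  rw [mem_graph_iff]
  constructor
  · rintro ⟨f, hf⟩
    refine sub_eq_zero.1 (hΓ.eq_zero_of_mem hz (f := f - γ h) ?_).2
    simpa [smul_sub] using Γ.sub_mem hf (hM h)
  · intro (hh : h' = M h)
    exact ⟨γ h, hh ▸ hM h⟩

theorem im_inner_eq (hΓ : SatisfiesB Γ) {z : ℂ} {M : K →L[ℂ] K}
    {γ : K →L[ℂ] H} (hM : IsWeylPair Γ z M γ) (x : K) :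
    (inner ℂ x (M x)).im = z.im * ‖γ x‖ ^ 2 := by
  have h1 := congrArg Complex.im (hΓ.green_of_mem (hM x) (hM x))
  rw [inner_self_eq_ofReal, Complex.im_mul_ofReal, ← inner_conj_symm (M x) x] at h1
  simp only [Complex.sub_im, Complex.conj_im, sub_neg_eq_add] at h1
  linarith

/-- `‖γ(z) - γ(w)‖ ≤ |z - w| ‖γ(w)‖ / |Im z|`, since the difference of the corresponding elements
of `Γ` lies over `ker Γ₀`, where the lower bound of a symmetric relation applies. -/
theorem norm_sub_le (hΓ : SatisfiesB Γ) {z w : ℂ} (hz : z ∈ nonreal) {M N : K →L[ℂ] K}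
    {γ δ : K →L[ℂ] H} (hM : IsWeylPair Γ z M γ) (hN : IsWeylPair Γ w N δ) :
    ‖γ - δ‖ ≤ ‖z - w‖ * ‖δ‖ / |z.im| := by
  have hz0 : 0 < |z.im| := abs_pos.2 hz
  refine ContinuousLinearMap.opNorm_le_bound _ (by positivity) fun x => ?_
  have h1 : (γ x - δ x, z • γ x - w • δ x) ∈ kerZero Γ :=
    ⟨M x - N x, by simpa using Γ.sub_mem (hM x) (hN x)⟩
  have h2 := hΓ.ker_zero.isSymm.abs_im_mul_norm_le z h1
  have h3 : z • γ x - w • δ x - z • (γ x - δ x) = (z - w) • δ x := by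
    rw [smul_sub, sub_smul]; abel
  simp only [h3, norm_smul] at h2
  rw [div_mul_eq_mul_div, le_div_iff₀ hz0, mul_comm]
  refine h2.trans ?_
  rw [mul_assoc]
  gcongr
  exact δ.le_opNorm x

variable {M : ℂ → K →L[ℂ] K} {γ : ℂ → K →L[ℂ] H}

theorem continuousAt_gammaField (hΓ : SatisfiesB Γ)
    (hM : ∀ z ∈ nonreal, IsWeylPair Γ z (M z) (γ z)) {w : ℂ} (hw : w ∈ nonreal) :
    ContinuousAt γ w := by
  have hnhds : ∀ᶠ z in 𝓝 w, z ∈ nonreal :=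
    (isOpen_ne_fun Complex.continuous_im continuous_const).mem_nhds hw
  rw [ContinuousAt, tendsto_iff_norm_sub_tendsto_zero]
  have hlim : Tendsto (fun z : ℂ => ‖z - w‖ * ‖γ w‖ / |z.im|) (𝓝 w) (𝓝 0) := by
    have hc : ContinuousAt (fun z : ℂ => ‖z - w‖ * ‖γ w‖ / |z.im|) w :=
      ContinuousAt.div (by fun_prop) (Complex.continuous_im.abs.continuousAt) (abs_ne_zero.2 hw)
    simpa [ContinuousAt] using hc
  refine squeeze_zero' (.of_forall fun _ => norm_nonneg _) ?_ hlim
  filter_upwards [hnhds] with z hz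
  exact hΓ.norm_sub_le hz (hM z hz) (hM w hw)

/-- The identity `M(z) - M(w) = (z - w) γ(w̄)* γ(z)` and the continuity of `γ` give
`M'(w) = γ(w̄)* γ(w)`. -/
theorem hasDerivAt_weylFunction [CompleteSpace H] [CompleteSpace K] (hΓ : SatisfiesB Γ)
    (hM : ∀ z ∈ nonreal, IsWeylPair Γ z (M z) (γ z)) {w : ℂ} (hw : w ∈ nonreal) :
    HasDerivAt M (ContinuousLinearMap.adjoint (γ (conj w)) ∘L γ w) w := by
  have hwc : conj w ∈ nonreal := by simpa [nonreal] using hw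
  have hnhds : ∀ᶠ z in 𝓝 w, z ∈ nonreal :=
    (isOpen_ne_fun Complex.continuous_im continuous_const).mem_nhds hw
  have hdiff {z : ℂ} (hz : z ∈ nonreal) :
      M z - M w = (z - w) • (ContinuousLinearMap.adjoint (γ (conj w)) ∘L γ z) := by
    ext x
    refine ext_inner_left ℂ fun k => ?_
    have h1 := hΓ.green_of_mem (hM z hz x) (hM _ hwc k)
    have h2 := hΓ.green_of_mem (hM w hw x) (hM _ hwc k)
    rw [Complex.conj_conj] at h1 h2
    rw [sub_self, zero_mul] at h2
    simp only [sub_apply, smul_apply, ContinuousLinearMap.comp_apply,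
      inner_sub_right, inner_smul_right, ContinuousLinearMap.adjoint_inner_right]
    rw [h1, sub_eq_zero.1 h2.symm]
  rw [hasDerivAt_iff_tendsto_slope]
  have hlim : Tendsto (fun z => ContinuousLinearMap.adjoint (γ (conj w)) ∘L γ z) (𝓝[≠] w)
      (𝓝 (ContinuousLinearMap.adjoint (γ (conj w)) ∘L γ w)) :=
    ((ContinuousLinearMap.compL ℂ K H K _).continuous.tendsto _).comp
      ((hΓ.continuousAt_gammaField hM hw).tendsto.mono_left nhdsWithin_le_nhds)
  refine hlim.congr' ?_
  filter_upwards [hnhds.filter_mono nhdsWithin_le_nhds, self_mem_nhdsWithin] with z hz hne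
  rw [slope_def_module, hdiff hz, smul_smul, inv_mul_cancel₀ (sub_ne_zero.2 hne), one_smul]

theorem differentiableOn_inverse [CompleteSpace H] [CompleteSpace K] (hΓ : SatisfiesB Γ)
    (hM : ∀ z ∈ nonreal, IsWeylPair Γ z (M z) (γ z)) {μ : ℂ} {s : Set ℂ}
    (hs : s ⊆ nonreal) (hu : ∀ z ∈ s, IsUnit (M z + μ • (1 : K →L[ℂ] K))) :
    DifferentiableOn ℂ (fun z => Ring.inverse (M z + μ • (1 : K →L[ℂ] K))) s := fun z hz =>
  (((hΓ.hasDerivAt_weylFunction hM (hs hz)).differentiableAt.add_const _).inverse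
    (hu z hz)).differentiableWithinAt

/-- For `Im z` and `Im μ` of equal sign, `|Im ((M(z) + μ) x, x)| ≥ |Im μ| ‖x‖²`. -/
theorem isUnit_weylFunction_add [CompleteSpace K] (hΓ : SatisfiesB Γ)
    (hM : ∀ z ∈ nonreal, IsWeylPair Γ z (M z) (γ z)) {z μ : ℂ} (h : 0 < z.im * μ.im) :
    IsUnit (M z + μ • (1 : K →L[ℂ] K)) := by
  have hz : z ∈ nonreal := left_ne_zero_of_mul h.ne'
  refine isUnit_of_mul_norm_sq_le_abs_im (abs_pos.2 (right_ne_zero_of_mul h.ne')) fun x => ?_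
  have h1 : (inner ℂ x ((M z + μ • (1 : K →L[ℂ] K)) x)).im
      = z.im * ‖γ z x‖ ^ 2 + μ.im * ‖x‖ ^ 2 := by
    simp only [add_apply, smul_apply, one_apply_eq_self, inner_add_right, inner_smul_right,
      Complex.add_im, inner_self_eq_ofReal, Complex.im_mul_ofReal, hΓ.im_inner_eq (hM z hz)]
  rw [h1]
  have h2 := sq_nonneg ‖γ z x‖
  have h3 := sq_nonneg ‖x‖
  rcases pos_and_pos_or_neg_and_neg_of_mul_pos h with ⟨ha, hb⟩ | ⟨ha, hb⟩
  · rw [abs_of_pos hb]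
    exact le_trans (by nlinarith) (le_abs_self _)
  · rw [abs_of_neg hb]
    exact le_trans (by nlinarith) (neg_le_abs _)

theorem isClassR_graph [CompleteSpace H] [CompleteSpace K] (hΓ : SatisfiesB Γ)
    (hM : ∀ z ∈ nonreal, IsWeylPair Γ z (M z) (γ z)) : IsClassR fun z => graph (M z) := by
  refine ⟨⟨fun z hz => ?_, fun z hz => ?_, fun z hz => ?_, fun μ hμ => ?_, fun μ hμ => ?_⟩,
    fun z hz h => ⟨M z h, mem_graph_iff.2 rfl⟩⟩
  · refine isMaxDissipative_graph fun h => ?_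
    rw [hΓ.im_inner_eq (hM z hz.ne')]
    positivity
  · refine isMaxAccumulative_graph fun h => ?_
    rw [hΓ.im_inner_eq (hM z hz.ne)]
    exact mul_nonpos_of_nonpos_of_nonneg hz.le (sq_nonneg _)
  · have hzc : conj z ∈ nonreal := by simpa [nonreal] using hz
    refine adjoint_graph fun x y => ?_
    have h1 := hΓ.green_of_mem (hM z hz y) (hM _ hzc x)
    rw [Complex.conj_conj, sub_self, zero_mul] at h1
    exact sub_eq_zero.1 h1.symm
  · have hu (z : ℂ) (hz : 0 < z.im) := hΓ.isUnit_weylFunction_add hM (mul_pos hz hμ)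
    exact ⟨_, hΓ.differentiableOn_inverse hM (fun z hz => ne_of_gt hz) hu,
      fun z hz => shiftInv_graph (hu z hz)⟩
  · have hu (z : ℂ) (hz : z.im < 0) := hΓ.isUnit_weylFunction_add hM (mul_pos_of_neg_of_neg hz hμ)
    exact ⟨_, hΓ.differentiableOn_inverse hM (fun z hz => ne_of_lt hz) hu,
      fun z hz => shiftInv_graph (hu z hz)⟩

end SatisfiesB

/-! ### Ordinary boundary triplets -/

/-- The graph `{{f̂, {Γ₀ f̂, Γ₁ f̂}} : f̂ ∈ A*}` of the pair of boundary mappings. -/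
def tripletRel (A : Submodule ℂ (H × H)) (Γ₀ Γ₁ : A.adjoint →ₗ[ℂ] K) :
    Submodule ℂ ((H × H) × (K × K)) :=
  LinearMap.range (A.adjoint.subtype.prod (Γ₀.prod Γ₁))

theorem mem_tripletRel {A : Submodule ℂ (H × H)} {Γ₀ Γ₁ : A.adjoint →ₗ[ℂ] K}
    {p : (H × H) × (K × K)} :
    p ∈ tripletRel A Γ₀ Γ₁ ↔ ∃ f : A.adjoint, ((f : H × H), (Γ₀ f, Γ₁ f)) = p :=
  Iff.rfl

namespace IsBoundaryTriplet

variable {A : Submodule ℂ (H × H)} {Γ₀ Γ₁ : A.adjoint →ₗ[ℂ] K}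

/-- The boundary mappings vanish on `A`: Green's identity against `A*` has zero left-hand side. -/
theorem apply_eq_zero (hΓ : IsBoundaryTriplet A Γ₀ Γ₁) {f : A.adjoint} (hf : (f : H × H) ∈ A) :
    Γ₀ f = 0 ∧ Γ₁ f = 0 := by
  have key (h h' : K) : inner ℂ h (Γ₁ f) - inner ℂ h' (Γ₀ f) = 0 := by
    obtain ⟨g, rfl, rfl⟩ := hΓ.surjective h h'
    rw [← hΓ.green, ← inner_conj_symm g.1.1, ← inner_conj_symm g.1.2,
      mem_adjoint_iff_inner_eq.1 g.2 _ hf, sub_self]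
  exact ⟨ext_inner_left ℂ fun k => by simpa using key 0 k,
    ext_inner_left ℂ fun k => by simpa using key k 0⟩

/-- Green's identity against all of `A*` characterizes the graph of `{Γ₀, Γ₁}`. -/
theorem exists_of_green (hA : IsSymm A) (hΓ : IsBoundaryTriplet A Γ₀ Γ₁) {q : H × H} {k k' : K}
    (hq : ∀ f : A.adjoint, inner ℂ q.1 f.1.2 - inner ℂ q.2 f.1.1
      = inner ℂ k (Γ₁ f) - inner ℂ k' (Γ₀ f)) :
    ∃ g : A.adjoint, (g : H × H) = q ∧ Γ₀ g = k ∧ Γ₁ g = k' := by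
  have hqA : q ∈ A.adjoint := by
    refine mem_adjoint_iff_inner_eq.2 fun p hp => ?_
    have h := hq ⟨p, hA.le_adjoint hp⟩
    obtain ⟨h0, h1⟩ := hΓ.apply_eq_zero (f := ⟨p, hA.le_adjoint hp⟩) hp
    rw [h0, h1, inner_zero_right, inner_zero_right, sub_self, sub_eq_zero] at h
    rw [← inner_conj_symm, h, inner_conj_symm]
  refine ⟨⟨q, hqA⟩, rfl, ?_⟩
  have key (h h' : K) : inner ℂ (Γ₀ ⟨q, hqA⟩ - k) h' - inner ℂ (Γ₁ ⟨q, hqA⟩ - k') h = 0 := by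
    obtain ⟨f, rfl, rfl⟩ := hΓ.surjective h h'
    have h1 := hΓ.green f ⟨q, hqA⟩
    have h2 := hq f
    simp only at h1
    rw [inner_sub_left, inner_sub_left]
    linear_combination h2 - h1
  refine ⟨sub_eq_zero.1 (ext_inner_right ℂ fun h' => ?_),
    sub_eq_zero.1 (ext_inner_right ℂ fun h => ?_)⟩
  · rw [inner_zero_left]
    simpa only [inner_zero_right, sub_zero] using key 0 h'
  · rw [inner_zero_left]
    simpa only [inner_zero_right, zero_sub, neg_eq_zero] using key h 0

theorem satisfiesB_tripletRel (hA : IsSymm A) (hΓ : IsBoundaryTriplet A Γ₀ Γ₁) :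
    SatisfiesB (tripletRel A Γ₀ Γ₁) := by
  refine ⟨?_, fun h => ?_, ?_⟩
  · rintro _ ⟨f, rfl⟩ _ ⟨g, rfl⟩
    exact hΓ.green f g
  · obtain ⟨f, rfl, -⟩ := hΓ.surjective h 0
    exact ⟨f, Γ₁ f, f, rfl⟩
  · have hker (f : A.adjoint) (hf : Γ₀ f = 0) : (f : H × H) ∈ kerZero (tripletRel A Γ₀ Γ₁) :=
      ⟨Γ₁ f, f, by rw [← hf]; rfl⟩
    ext q
    rw [mem_adjoint_iff_inner_eq]
    constructor
    · intro hq
      have hqA : q ∈ A.adjoint := mem_adjoint_iff_inner_eq.2 fun p hp =>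
        hq p (hker ⟨p, hA.le_adjoint hp⟩ (hΓ.apply_eq_zero hp).1)
      refine hker ⟨q, hqA⟩ (ext_inner_right ℂ fun h' => ?_)
      obtain ⟨f, hf0, rfl⟩ := hΓ.surjective 0 h'
      have h1 := hΓ.green f ⟨q, hqA⟩
      rw [hf0, inner_zero_right, sub_zero, ← inner_conj_symm q.1, ← inner_conj_symm q.2,
        hq _ (hker f hf0), sub_self] at h1
      rw [← h1, inner_zero_left]
    · rintro ⟨k', g, hg⟩ p ⟨h', f, hf⟩
      obtain ⟨rfl, hg0, -⟩ : (g : H × H) = q ∧ Γ₀ g = 0 ∧ Γ₁ g = k' := by simpa using hg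
      obtain ⟨rfl, hf0, -⟩ : (f : H × H) = p ∧ Γ₀ f = 0 ∧ Γ₁ f = h' := by simpa using hf
      have h1 := hΓ.green g f
      rw [hf0, hg0, inner_zero_left, inner_zero_right, sub_self, sub_eq_zero] at h1
      exact h1.symm

end IsBoundaryTriplet

/-! ### Orthogonal sums of relations -/

theorem isSymm_orthSum {R : Submodule ℂ (H × H)} {R' : Submodule ℂ (G × G)} (hR : IsSymm R)
    (hR' : IsSymm R') : IsSymm (H := WithLp 2 (H × G)) (orthSum R R') := by
  intro p hp
  rw [WithLp.prod_inner_apply, Complex.add_im]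
  exact (congrArg₂ (· + ·) (hR _ hp.1) (hR' _ hp.2)).trans (add_zero 0)

theorem isClosed_orthSum {R : Submodule ℂ (H × H)} {R' : Submodule ℂ (G × G)}
    (hR : IsClosed (R : Set (H × H))) (hR' : IsClosed (R' : Set (G × G))) :
    IsClosed (orthSum R R' : Set (WithLp 2 (H × G) × WithLp 2 (H × G))) := by
  refine IsClosed.inter (hR.preimage (f := fun p : WithLp 2 (H × G) × WithLp 2 (H × G) =>
    (p.1.fst, p.2.fst)) ?_) (hR'.preimage (f := fun p : WithLp 2 (H × G) × WithLp 2 (H × G) =>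
    (p.1.snd, p.2.snd)) ?_)
  · exact ((WithLp.fstL 2 ℂ H G).continuous.comp continuous_fst).prodMk
      ((WithLp.fstL 2 ℂ H G).continuous.comp continuous_snd)
  · exact ((WithLp.sndL 2 ℂ H G).continuous.comp continuous_fst).prodMk
      ((WithLp.sndL 2 ℂ H G).continuous.comp continuous_snd)

theorem adjoint_orthSum (R : Submodule ℂ (H × H)) (R' : Submodule ℂ (G × G)) :
    Submodule.adjoint (E := WithLp 2 (H × G)) (F := WithLp 2 (H × G)) (orthSum R R')
      = orthSum R.adjoint R'.adjoint := by
  ext q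
  rw [mem_adjoint_iff_inner_eq]
  constructor
  · refine fun hq => ⟨mem_adjoint_iff_inner_eq.2 fun p hp => ?_,
      mem_adjoint_iff_inner_eq.2 fun p hp => ?_⟩
    · have h := hq (WithLp.toLp 2 (p.1, 0), WithLp.toLp 2 (p.2, 0)) ⟨hp, R'.zero_mem⟩
      simpa [WithLp.prod_inner_apply] using h
    · have h := hq (WithLp.toLp 2 (0, p.1), WithLp.toLp 2 (0, p.2)) ⟨R.zero_mem, hp⟩
      simpa [WithLp.prod_inner_apply] using h
  · intro hq p hp
    rw [WithLp.prod_inner_apply, WithLp.prod_inner_apply]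
    exact congrArg₂ (· + ·) (mem_adjoint_iff_inner_eq.1 hq.1 _ hp.1)
      (mem_adjoint_iff_inner_eq.1 hq.2 _ hp.2)

/-! ### The coupling of a boundary triplet and a boundary relation -/

section Coupling

variable {A : Submodule ℂ (H × H)} {Γ₀ Γ₁ : A.adjoint →ₗ[ℂ] K}
  {χ : Submodule ℂ ((G × G) × (K × K))}

theorem mk_mem_couplRel (f : A.adjoint) {g g' : G} {h h' : K} (hm : ((g, g'), (h, h')) ∈ χ) :
    ((WithLp.toLp 2 (f.1.1, g), WithLp.toLp 2 (f.1.2, g')),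
      (WithLp.toLp 2 (h' + Γ₁ f, h - Γ₀ f), WithLp.toLp 2 (-Γ₀ f, h'))) ∈ couplRel A Γ₀ Γ₁ χ :=
  ⟨f, g, g', h, h', hm, rfl⟩

theorem greenAt_couplRel (hΓ : IsBoundaryTriplet A Γ₀ Γ₁)
    (hχ : ∀ p ∈ χ, ∀ q ∈ χ, GreenAt p q) :
    ∀ p ∈ couplRel A Γ₀ Γ₁ χ, ∀ q ∈ couplRel A Γ₀ Γ₁ χ,
      GreenAt (H := WithLp 2 (H × G)) (K := WithLp 2 (K × K)) p q := by
  rintro _ ⟨f, f₂, f₂', h, h', hf, rfl⟩ _ ⟨g, g₂, g₂', k, k', hg, rfl⟩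
  have h1 := hΓ.green f g
  have h2 := hχ _ hf _ hg
  simp only [GreenAt, WithLp.prod_inner_apply, inner_add_left, inner_add_right, inner_sub_left,
    inner_sub_right, inner_neg_left, inner_neg_right] at h2 ⊢
  linear_combination h1 + h2

theorem couplRel_maximal (hA : IsSymm A) (hΓ : IsBoundaryTriplet A Γ₀ Γ₁)
    (hχ : ∀ q : (G × G) × (K × K), (∀ p ∈ χ, GreenAt p q) → q ∈ χ)
    (q : (WithLp 2 (H × G) × WithLp 2 (H × G)) × (WithLp 2 (K × K) × WithLp 2 (K × K)))
    (hq : ∀ p ∈ couplRel A Γ₀ Γ₁ χ,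
      GreenAt (H := WithLp 2 (H × G)) (K := WithLp 2 (K × K)) p q) :
    q ∈ couplRel A Γ₀ Γ₁ χ := by
  obtain ⟨⟨⟨x, y⟩, ⟨x', y'⟩⟩, ⟨⟨a, b⟩, ⟨c, d⟩⟩⟩ := q
  -- testing against `f̂₂ = 0` identifies the component in `A*`
  obtain ⟨g, hg, hg0, hg1⟩ := hΓ.exists_of_green hA (q := (x, x')) (k := -c) (k' := a - d)
    fun f => by
      have h := hq _ (mk_mem_couplRel f χ.zero_mem)
      simp only [GreenAt, WithLp.prod_inner_apply, inner_add_right, inner_sub_left,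
        inner_sub_right, inner_neg_left, inner_neg_right, inner_zero_right] at h ⊢
      linear_combination h
  -- testing against `f̂₁ = 0` identifies the component in `χ`
  have hmem : ((y, y'), (b - c, d)) ∈ χ := by
    refine hχ _ fun ⟨⟨u, u'⟩, ⟨h, h'⟩⟩ hp => ?_
    have h := hq _ (mk_mem_couplRel (0 : A.adjoint) hp)
    simp only [GreenAt, WithLp.prod_inner_apply, map_zero, Submodule.coe_zero, Prod.fst_zero,
      Prod.snd_zero, neg_zero, sub_zero, add_zero, inner_sub_left, inner_zero_right] at h ⊢
    linear_combination h
  refine ⟨g, y, y', b - c, d, hmem, ?_⟩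
  rw [hg, hg0, hg1]
  simp

theorem satisfiesB_couplRel (hA : IsSymm A) (hΓ : IsBoundaryTriplet A Γ₀ Γ₁)
    (hχ : ∀ p ∈ χ, ∀ q ∈ χ, GreenAt p q)
    (hχ' : ∀ q : (G × G) × (K × K), (∀ p ∈ χ, GreenAt p q) → q ∈ χ) :
    SatisfiesB (H := WithLp 2 (H × G)) (K := WithLp 2 (K × K)) (couplRel A Γ₀ Γ₁ χ) := by
  have hgreen := greenAt_couplRel hΓ hχ
  refine ⟨hgreen, ?_, ?_⟩
  · rintro ⟨a, b⟩
    obtain ⟨f, hf0, hf1⟩ := hΓ.surjective (-b) a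
    have h := mk_mem_couplRel (Γ₀ := Γ₀) (Γ₁ := Γ₁) f χ.zero_mem
    rw [hf0, hf1] at h
    exact ⟨_, _, by simpa using h⟩
  · have hker (f : A.adjoint) {g g' : G} {h h' : K} (hm : ((g, g'), (h, h')) ∈ χ)
        (h0 : Γ₀ f = h) (h1 : Γ₁ f = -h') :
        (WithLp.toLp 2 (f.1.1, g), WithLp.toLp 2 (f.1.2, g')) ∈
          kerZero (H := WithLp 2 (H × G)) (K := WithLp 2 (K × K)) (couplRel A Γ₀ Γ₁ χ) := by
      have h := mk_mem_couplRel (Γ₀ := Γ₀) (Γ₁ := Γ₁) f hm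
      rw [h0, h1, add_neg_cancel, sub_self] at h
      exact ⟨_, h⟩
    ext ⟨⟨x, y⟩, ⟨x', y'⟩⟩
    rw [mem_adjoint_iff_inner_eq]
    constructor
    · intro hq
      have hqA : (x, x') ∈ A.adjoint := mem_adjoint_iff_inner_eq.2 fun p hp => by
        obtain ⟨h0, h1⟩ := hΓ.apply_eq_zero (f := ⟨p, hA.le_adjoint hp⟩) hp
        have h := hq _ (hker ⟨p, hA.le_adjoint hp⟩ χ.zero_mem h0 (by rw [h1, neg_zero]))
        simpa [WithLp.prod_inner_apply] using h
      set g : A.adjoint := ⟨(x, x'), hqA⟩ with hg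
      refine hker g (h := Γ₀ g) (h' := -Γ₁ g) (hχ' _ fun ⟨⟨u, u'⟩, ⟨h, h'⟩⟩ hp => ?_) rfl
        (neg_neg _).symm
      -- pair `q` with the element of `ker Γ₀` lying over the given element of `χ`
      obtain ⟨f, rfl, hf1⟩ := hΓ.surjective h (-h')
      have h1 := hq _ (hker f hp rfl hf1)
      have h1 := congrArg conj h1
      have h2 := hΓ.green f g
      simp only [WithLp.prod_inner_apply, map_add, inner_conj_symm] at h1
      rw [hf1] at h2
      simp only [GreenAt, inner_neg_left, inner_neg_right, hg] at h2 ⊢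
      linear_combination h1 - h2
    · rintro ⟨k', hk⟩ p ⟨h', hh⟩
      have h := hgreen _ hk _ hh
      simp only [GreenAt, inner_zero_left, inner_zero_right, sub_self, sub_eq_zero] at h
      exact h.symm

theorem isBoundaryRelation_couplRel (hA : IsSymm A) (hΓ : IsBoundaryTriplet A Γ₀ Γ₁)
    {S : Submodule ℂ (G × G)} (hS : IsSymm S) (hχ : IsBoundaryRelation S.adjoint χ) :
    IsBoundaryRelation (H := WithLp 2 (H × G)) (K := WithLp 2 (K × K))
      (orthSum A.adjoint S.adjoint) (couplRel A Γ₀ Γ₁ χ) where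
  isAdjoint := by
    refine ⟨orthSum A.topologicalClosure S.topologicalClosure,
      isClosed_orthSum A.isClosed_topologicalClosure S.isClosed_topologicalClosure,
      isSymm_orthSum hA.topologicalClosure hS.topologicalClosure, ?_⟩
    rw [adjoint_orthSum, adjoint_topologicalClosure, adjoint_topologicalClosure]
  dom_le := by
    rintro _ ⟨f, g, g', h, h', hm, rfl⟩
    exact ⟨f.2, hχ.dom_le _ hm⟩
  dom_dense := by
    rintro ⟨⟨x, y⟩, ⟨x', y'⟩⟩ ⟨hx, hy⟩
    -- only the second component has to be approximated
    let F : G × G → WithLp 2 (H × G) × WithLp 2 (H × G) := fun g =>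
      (WithLp.toLp 2 (x, g.1), WithLp.toLp 2 (x', g.2))
    have hF : Continuous F := by
      refine Continuous.prodMk ?_ ?_ <;>
        exact (WithLp.prod_continuous_toLp 2 H G).comp (by fun_prop)
    refine map_mem_closure (f := F) hF (hχ.dom_dense _ hy) ?_
    rintro ⟨g, g'⟩ ⟨h, hm⟩
    exact ⟨_, mk_mem_couplRel (⟨(x, x'), hx⟩ : A.adjoint) hm⟩
  green := greenAt_couplRel hΓ hχ.green
  maximal := couplRel_maximal hA hΓ hχ.maximal

theorem mk_mem_weylFamily_couplRel {z : ℂ} {M : K →L[ℂ] K} {γ : K →L[ℂ] H}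
    (hM : IsWeylPair (tripletRel A Γ₀ Γ₁) z M γ) (u : K) {h h' : K}
    (hh : (h, h') ∈ weylFamily χ z) :
    (WithLp.toLp 2 (h' + M u, h - u), WithLp.toLp 2 (-u, h')) ∈
      weylFamily (H := WithLp 2 (H × G)) (K := WithLp 2 (K × K)) (couplRel A Γ₀ Γ₁ χ) z := by
  obtain ⟨g, hg⟩ := hh
  obtain ⟨f, hf⟩ := mem_tripletRel.1 (hM u)
  obtain ⟨hf, rfl, hf1⟩ : (f : H × H) = (γ u, z • γ u) ∧ Γ₀ f = u ∧ Γ₁ f = M u := by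
    simpa using hf
  have h := mk_mem_couplRel (Γ₀ := Γ₀) (Γ₁ := Γ₁) f hg
  rw [hf1, hf] at h
  exact ⟨WithLp.toLp 2 (γ (Γ₀ f), g), h⟩

/-- The block formula comes from solving `Ψ x + M u = a`, `Φ x - u = b` for `x` and `u`, where
`u` is the value of `Γ₀` on the defect element of `A*`: the value of the Weyl function at
`(a, b)` is `(-u, Ψ x)`. -/
theorem weylFunction_couplRel_eq [CompleteSpace K] {z : ℂ} {M Φ Ψ : K →L[ℂ] K}
    {γ : K →L[ℂ] H} (hM : IsWeylPair (tripletRel A Γ₀ Γ₁) z M γ)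
    (hχ : weylFamily χ z = pairRel Φ Ψ) (hinj : ∀ x, Φ x = 0 → Ψ x = 0 → x = 0)
    {Mc : WithLp 2 (K × K) →L[ℂ] WithLp 2 (K × K)}
    (hMc : weylFamily (H := WithLp 2 (H × G)) (K := WithLp 2 (K × K)) (couplRel A Γ₀ Γ₁ χ) z
      = graph Mc)
    (hΓM : ∀ f : A.adjoint, f.1.2 = z • f.1.1 → Γ₁ f = M (Γ₀ f)) :
    IsUnit (Ψ + M * Φ) ∧
      Mc = blockOp (-(Φ * Ring.inverse (Ψ + M * Φ))) (1 - Φ * Ring.inverse (Ψ + M * Φ) * M)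
        (Ψ * Ring.inverse (Ψ + M * Φ)) (Ψ * Ring.inverse (Ψ + M * Φ) * M) := by
  have hval (u x : K) :
      Mc (WithLp.toLp 2 (Ψ x + M u, Φ x - u)) = WithLp.toLp 2 (-u, Ψ x) := by
    refine (mem_graph_iff.1 (hMc ▸ mk_mem_weylFamily_couplRel hM u ?_)).symm
    rw [hχ]
    exact ⟨x, rfl⟩
  have hunit : IsUnit (Ψ + M * Φ) := by
    rw [ContinuousLinearMap.isUnit_iff_bijective]
    constructor
    · refine (injective_iff_map_eq_zero _).2 fun x hx => ?_
      have h := hval (Φ x) x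
      have hx' : Ψ x + M (Φ x) = 0 := hx
      rw [hx', sub_self, ← Prod.zero_eq_mk, WithLp.toLp_zero, map_zero] at h
      have h1 := congrArg WithLp.fst h
      have h2 := congrArg WithLp.snd h
      exact hinj x (neg_eq_zero.1 h1.symm) h2.symm
    · intro a
      have h : (WithLp.toLp 2 (a, 0), Mc (WithLp.toLp 2 (a, 0))) ∈ weylFamily
          (H := WithLp 2 (H × G)) (K := WithLp 2 (K × K)) (couplRel A Γ₀ Γ₁ χ) z :=
        hMc ▸ mem_graph_iff.2 rfl
      obtain ⟨w, f, g, g', h, h', hm, heq⟩ := h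
      simp only [Prod.mk.injEq] at heq
      obtain ⟨⟨hw, hw'⟩, hv, -⟩ := heq
      have hf : f.1.2 = z • f.1.1 := by
        rw [hw] at hw'
        exact (congrArg WithLp.fst hw').symm
      have hg : g' = z • g := by
        rw [hw] at hw'
        exact (congrArg WithLp.snd hw').symm
      have hmem : (h, h') ∈ weylFamily χ z := ⟨g, hg ▸ hm⟩
      rw [hχ] at hmem
      obtain ⟨x, hx⟩ := hmem
      obtain ⟨rfl, rfl⟩ : Φ x = h ∧ Ψ x = h' := by simpa using hx
      have hv1 : a = Ψ x + Γ₁ f := congrArg WithLp.fst hv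
      have hv2 : 0 = Φ x - Γ₀ f := congrArg WithLp.snd hv
      refine ⟨x, ?_⟩
      rw [hv1, hΓM f hf, ← sub_eq_zero.1 hv2.symm]
      rfl
  refine ⟨hunit, ?_⟩
  ext1 ⟨a, b⟩
  set N := Ring.inverse (Ψ + M * Φ) with hN
  have hNx (y : K) : Ψ (N y) + M (Φ (N y)) = y :=
    DFunLike.congr_fun (Ring.mul_inverse_cancel _ hunit) y
  have h := hval (Φ (N (a + M b)) - b) (N (a + M b))
  rw [map_sub, ← add_sub_assoc, hNx, add_sub_cancel_right, sub_sub_cancel] at h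
  rw [h]
  refine congrArg (WithLp.toLp 2) (Prod.ext ?_ ?_)
  · change -(Φ (N (a + M b)) - b) = -(Φ (N a)) + (b - Φ (N (M b)))
    rw [map_add, map_add]
    abel
  · change Ψ (N (a + M b)) = Ψ (N a) + Ψ (N (M b))
    rw [map_add, map_add]

end Coupling

end LinRel

end

open LinRel

theorem theorem6p6 {H₁ H₂ K : Type*}
    [NormedAddCommGroup H₁] [InnerProductSpace ℂ H₁] [CompleteSpace H₁]
    [NormedAddCommGroup H₂] [InnerProductSpace ℂ H₂] [CompleteSpace H₂]
    [NormedAddCommGroup K] [InnerProductSpace ℂ K] [CompleteSpace K]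
    (A : Submodule ℂ (H₁ × H₁)) (hA : LinRel.IsSymm A)
    (Γ₀ Γ₁ : A.adjoint →ₗ[ℂ] K) (hΓ : LinRel.IsBoundaryTriplet A Γ₀ Γ₁)
    (S₂ : Submodule ℂ (H₂ × H₂)) (hS₂ : LinRel.IsSymm S₂)
    (χ : Submodule ℂ ((H₂ × H₂) × (K × K))) (hχ : LinRel.IsBoundaryRelation S₂.adjoint χ) :
    (LinRel.IsBoundaryRelation (LinRel.orthSum A.adjoint S₂.adjoint)
        (LinRel.couplRel A Γ₀ Γ₁ χ) ∧
      LinRel.SatisfiesB (H := WithLp 2 (H₁ × H₂)) (K := WithLp 2 (K × K))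
        (LinRel.couplRel A Γ₀ Γ₁ χ)) ∧
    ∃ Mc : ℂ → WithLp 2 (K × K) →L[ℂ] WithLp 2 (K × K),
      (∀ z ∈ LinRel.nonreal,
        LinRel.weylFamily (H := WithLp 2 (H₁ × H₂)) (K := WithLp 2 (K × K))
          (LinRel.couplRel A Γ₀ Γ₁ χ) z = LinRel.graph (Mc z)) ∧
      LinRel.IsClassR (fun z => LinRel.graph (Mc z)) ∧
      ∀ M : ℂ → K →L[ℂ] K, LinRel.IsWeylFunction A Γ₀ Γ₁ M →
        ∀ Φ Ψ : ℂ → K →L[ℂ] K, LinRel.IsNevanlinnaPair Φ Ψ →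
          (∀ z ∈ LinRel.nonreal, LinRel.weylFamily χ z = LinRel.pairRel (Φ z) (Ψ z)) →
          ∀ z ∈ LinRel.nonreal,
            IsUnit (Ψ z + M z * Φ z) ∧
            Mc z = LinRel.blockOp
              (-(Φ z * Ring.inverse (Ψ z + M z * Φ z)))
              (1 - Φ z * Ring.inverse (Ψ z + M z * Φ z) * M z)
              (Ψ z * Ring.inverse (Ψ z + M z * Φ z))
              (Ψ z * Ring.inverse (Ψ z + M z * Φ z) * M z) := by
  have hB := satisfiesB_couplRel hA hΓ hχ.green hχ.maximal
  refine ⟨⟨isBoundaryRelation_couplRel hA hΓ hS₂ hχ, hB⟩, ?_⟩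
  have hex (z : ℂ) : ∃ (N : WithLp 2 (K × K) →L[ℂ] WithLp 2 (K × K))
      (γ : WithLp 2 (K × K) →L[ℂ] WithLp 2 (H₁ × H₂)), z ∈ nonreal →
        IsWeylPair (H := WithLp 2 (H₁ × H₂)) (K := WithLp 2 (K × K))
          (couplRel A Γ₀ Γ₁ χ) z N γ := by
    by_cases hz : z ∈ nonreal
    · obtain ⟨N, γ, h⟩ := hB.exists_isWeylPair hz
      exact ⟨N, γ, fun _ => h⟩
    · exact ⟨0, 0, fun h => absurd h hz⟩
  choose Mc γc hMc using hex
  have hgraph (z : ℂ) (hz : z ∈ nonreal) := hB.weylFamily_eq_graph hz (hMc z hz)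
  refine ⟨Mc, hgraph, hB.isClassR_graph hMc, fun M hM Φ Ψ hP hτ z hz => ?_⟩
  obtain ⟨N, γ, hN⟩ := (hΓ.satisfiesB_tripletRel hA).exists_isWeylPair hz
  -- the Weyl function of the triplet is determined by its defining property
  have hNM : N = M z := by
    ext u
    obtain ⟨f, hf⟩ := mem_tripletRel.1 (hN u)
    obtain ⟨hf, rfl, hf1⟩ : (f : H₁ × H₁) = (γ u, z • γ u) ∧ Γ₀ f = u ∧ Γ₁ f = N u := by
      simpa using hf
    rw [← hf1]
    exact hM z hz f (by rw [hf])
  subst hNM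
  refine weylFunction_couplRel_eq hN (hτ z hz) (fun x h0 h1 => ?_) (hgraph z hz) (hM z hz)
  rcases lt_or_gt_of_ne (show z.im ≠ 0 from hz) with h | h
  · exact ((ContinuousLinearMap.isUnit_iff_bijective.1 (hP.invertible_lower z h)).1).eq_iff'
      (map_zero _) |>.1 (by simp [h0, h1])
  · exact ((ContinuousLinearMap.isUnit_iff_bijective.1 (hP.invertible_upper z h)).1).eq_iff'
      (map_zero _) |>.1 (by simp [h0, h1])
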